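/- Let $\lambda_0>0$ and $R_c\ge 0$, let $\Phi$ be a homogeneous Poisson point process of density $\lambda_0$ in $\mathbb{R}^2$ and $\Psi=\Phi\cup\{o\}$, where $o$ is the origin. Let $\mathcal{V}_\Psi(o)=\{x\in\mathbb{R}^2 : \|x\|\le\|x-b\| \text{ for all } b\in\Psi\}$ be the typical Poisson–Voronoi cell, and let $$X_E=\bigl|\{x\in\mathcal{V}_\Psi(o) : \|x\|>R_c\}\bigr|$$ be its cell-edge area. Then $X_E$ is an almost surely finite random variable, its mean is $$\mathbb{E}[X_E]=\frac{\exp(-\pi\lambda_0R_c^2)}{\lambda_0},$$ and its second moment is finite and equal to $$\mathbb{E}[X_E^2]=2\pi\int_{R_c}^{\infty}\int_{R_c}^{\infty}\int_0^{2\pi}\exp\bigl(-\lambda_0V(r_1,r_2,u)\bigr)\,du\,r_2\,dr_2\,r_1\,dr_1 ,$$ where the triple integral converges absolutely. Here, for $r_1,r_2>0$, $V(r_1,r_2,u)$ is the area of the union of two discs of radii $r_1$ and $r_2$ whose centres are at distances $r_1$ and $r_2$ from $o$ (so that both bounding circles pass through $o$) and have angular separation $u$ seen from $o$; this area depends only on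 $r_1,r_2,u$, and, whenever the two centres are distinct, $$V(r_1,r_2,u)=r_1^2\Bigl(\pi-v+\tfrac{\sin(2v)}{2}\Bigr)+r_2^2\Bigl(\pi-w+\tfrac{\sin(2w)}{2}\Bigr),$$ with $$v=\arccos\frac{r_1-r_2\cos u}{\sqrt{r_1^2+r_2^2-2r_1r_2\cos u}},\qquad w=\arccos\frac{r_2-r_1\cos u}{\sqrt{r_1^2+r_2^2-2r_1r_2\cos u}} .$$ -/

import Mathlib

open MeasureTheory ProbabilityTheory

namespace PoissonVoronoi

/-- The Euclidean plane. -/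
abbrev Plane : Type := EuclideanSpace ℝ (Fin 2)

/-- `Φ`, a random set of points of the measurable metric space `E` defined on the probability
space `(Ω, P)`, is a Poisson point process with intensity measure `ν`: its realizations are locally
finite, the number of points in each Borel set is a random variable, this number is Poisson with
mean `ν B` whenever `ν B` is finite, and the numbers of points in finitely many pairwise disjoint
Borel sets are independent. -/
structure IsPoissonPointProcess {Ω E : Type*} [MeasurableSpace Ω] [PseudoMetricSpace E]
    [MeasurableSpace E] (Φ : Ω → Set E) (ν : Measure E) (P : Measure Ω) : Prop where
  locallyFinite : ∀ ω, ∀ B : Set E, Bornology.IsBounded B → (Φ ω ∩ B).Finite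
  measurable_count : ∀ B : Set E, MeasurableSet B → Measurable fun ω => (Φ ω ∩ B).encard
  law_count : ∀ B : Set E, MeasurableSet B → ν B ≠ ⊤ →
    P.map (fun ω => (Φ ω ∩ B).encard) =
      (poissonMeasure (ν B).toNNReal).map (fun n : ℕ => (n : ℕ∞))
  indep_count : ∀ (n : ℕ) (B : Fin n → Set E), (∀ i, MeasurableSet (B i)) →
    Pairwise (fun i j => Disjoint (B i) (B j)) →
    iIndepFun (fun (i : Fin n) (ω : Ω) => (Φ ω ∩ B i).encard) P

/-- A homogeneous Poisson point process of density `lam` in the plane. -/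
def IsHomogeneousPPP {Ω : Type*} [MeasurableSpace Ω] (Φ : Ω → Set Plane) (lam : ℝ)
    (P : Measure Ω) : Prop :=
  IsPoissonPointProcess Φ (ENNReal.ofReal lam • (volume : Measure Plane)) P

/-- The (closed) Voronoi cell of the point `b` with respect to the set of points `S`. -/
def voronoiCell (S : Set Plane) (b : Plane) : Set Plane :=
  {x | ∀ p ∈ S, dist x b ≤ dist x p}

/-- The cell-edge region: the points of the Voronoi cell of `b` at distance more than `R`
from `b`. -/
def cellEdgeRegion (S : Set Plane) (b : Plane) (R : ℝ) : Set Plane :=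
  {x ∈ voronoiCell S b | R < dist x b}

/-- The cell-edge region of the typical cell, that is, of the cell of the origin, in the
configuration obtained from `S` by adding the origin. -/
def typicalCellEdgeRegion (S : Set Plane) (R : ℝ) : Set Plane :=
  cellEdgeRegion (S ∪ {0}) 0 R

/-- The cell-edge area of the typical cell. -/
noncomputable def typicalCellEdgeArea (S : Set Plane) (R : ℝ) : ℝ :=
  (volume : Measure Plane).real (typicalCellEdgeRegion S R)

/-- The point with polar coordinates `(r, θ)`. -/
noncomputable def polarPoint (r θ : ℝ) : Plane :=
  !₂[r * Real.cos θ, r * Real.sin θ]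

/-- The area of the union of the disc of radius `r₁` centred at the point with polar coordinates
`(r₁, θ₁)` and the disc of radius `r₂` centred at the point with polar coordinates `(r₂, θ₂)`; the
bounding circles of both discs pass through the origin. -/
noncomputable def discUnionArea (r₁ θ₁ r₂ θ₂ : ℝ) : ℝ :=
  (volume : Measure Plane).real
    (Metric.closedBall (polarPoint r₁ θ₁) r₁ ∪ Metric.closedBall (polarPoint r₂ θ₂) r₂)

/-- `V(r₁, r₂, u)`: the area of the union of two discs of radii `r₁`, `r₂` whose bounding circles
pass through the origin and whose centres have angular separation `u` seen from the origin. -/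
noncomputable def V (r₁ r₂ u : ℝ) : ℝ :=
  discUnionArea r₁ 0 r₂ u

/-- The angle `v(r₁, r₂, u)`. -/
noncomputable def vAngle (r₁ r₂ u : ℝ) : ℝ :=
  Real.arccos ((r₁ - r₂ * Real.cos u) /
    Real.sqrt (r₁ ^ 2 + r₂ ^ 2 - 2 * r₁ * r₂ * Real.cos u))

/-- The angle `w(r₁, r₂, u)`. -/
noncomputable def wAngle (r₁ r₂ u : ℝ) : ℝ :=
  Real.arccos ((r₂ - r₁ * Real.cos u) /
    Real.sqrt (r₁ ^ 2 + r₂ ^ 2 - 2 * r₁ * r₂ * Real.cos u))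

end PoissonVoronoi

namespace PoissonVoronoi

open Set Filter Topology
open scoped ENNReal

/-! A point `x` lies in the cell of `o` exactly when the open disc about `x` through `o` contains no
point of `Φ`, which has probability `exp (-λπ‖x‖²)`. Two points lie in it together exactly when the
union of their discs is empty, with probability `exp (-λ · area of the union)`. The area is the
integral of the indicator of the region, so Tonelli turns its first moment into an integral of the
one-point probability over the plane, and its second into an integral of the two-point probability
over pairs. Polar coordinates make the mean an explicit Gaussian integral. In the second moment
rotation invariance leaves only the angular separation `u`, and the free angle gives the factor
`2π`. Moments are computed in `ℝ≥0∞`, so almost sure finiteness and square integrability follow from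
finite values. The second is finite because `V` dominates `π/2 (r₁² + r₂²)`. For the closed form of
`V`, a disc through `o` has radial function `2r cos (φ - θ)`. The union has the larger of the two,
and which one is larger changes only along the line of the common chord. -/

/-! ### Periodic integrals and polar coordinates in the plane -/

theorem setLIntegral_Ioc_eq_of_periodic {f : ℝ → ℝ≥0∞} {T : ℝ} (hT : 0 < T)
    (hf : Function.Periodic f T) (s t : ℝ) :
    ∫⁻ x in Ioc s (s + T), f x = ∫⁻ x in Ioc t (t + T), f x := by
  refine (isAddFundamentalDomain_Ioc hT s).setLIntegral_eq (isAddFundamentalDomain_Ioc hT t) f ?_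
  rintro ⟨_, n, rfl⟩ x
  simpa [AddSubgroup.vadd_def, add_comm] using hf.int_mul n x

theorem setLIntegral_Ioc_sub_of_periodic {f : ℝ → ℝ≥0∞} {T : ℝ} (hT : 0 < T)
    (hf : Function.Periodic f T) (a s : ℝ) :
    ∫⁻ x in Ioc s (s + T), f (x - a) = ∫⁻ x in Ioc s (s + T), f x := by
  have h := (measurePreserving_sub_right (volume : Measure ℝ) a).setLIntegral_comp_preimage_emb
    (measurableEmbedding_subRight a) f (Ioc (s - a) (s - a + T))
  rw [setLIntegral_Ioc_eq_of_periodic hT hf s (s - a), ← h]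
  simp [sub_add_eq_add_sub]

theorem measurePreserving_toPlane :
    MeasurePreserving (fun p : ℝ × ℝ => (!₂[p.1, p.2] : Plane)) volume volume := by
  have h := (EuclideanSpace.volume_preserving_symm_measurableEquiv_toLp (Fin 2)).symm.comp
    (volume_preserving_finTwoArrow ℝ).symm
  exact h

theorem polarPoint_add_two_pi (r θ : ℝ) : polarPoint r (θ + 2 * Real.pi) = polarPoint r θ := by
  simp [polarPoint]

theorem continuous_polarPoint : Continuous fun p : ℝ × ℝ => polarPoint p.1 p.2 := by
  unfold polarPoint
  refine (PiLp.continuous_toLp 2 _).comp (continuous_pi fun i => ?_)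
  fin_cases i <;> simp <;> fun_prop

theorem norm_polarPoint (r θ : ℝ) : ‖polarPoint r θ‖ = |r| := by
  rw [EuclideanSpace.norm_eq, ← Real.sqrt_sq_eq_abs]
  simp [polarPoint, Fin.sum_univ_two]
  congr 1
  linear_combination r ^ 2 * Real.cos_sq_add_sin_sq θ

theorem lintegral_eq_polar {f : Plane → ℝ≥0∞} (hf : Measurable f) :
    ∫⁻ z, f z = ∫⁻ r in Ioi (0 : ℝ), ∫⁻ θ in Ioc 0 (2 * Real.pi),
      ENNReal.ofReal r * f (polarPoint r θ) := by
  have hp : ∀ p : ℝ × ℝ, (!₂[(polarCoord.symm p).1, (polarCoord.symm p).2] : Plane) =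
      polarPoint p.1 p.2 := fun p => by simp [polarPoint]
  have hm : Measurable fun p : ℝ × ℝ => ENNReal.ofReal p.1 * f (polarPoint p.1 p.2) :=
    (ENNReal.measurable_ofReal.comp measurable_fst).mul (hf.comp continuous_polarPoint.measurable)
  rw [← measurePreserving_toPlane.lintegral_comp hf, ← lintegral_comp_polarCoord_symm]
  simp only [hp, smul_eq_mul, polarCoord_target]
  rw [Measure.volume_eq_prod, ← Measure.prod_restrict, lintegral_prod _ hm.aemeasurable]
  refine setLIntegral_congr_fun measurableSet_Ioi fun r _ => ?_
  have hper : Function.Periodic (fun θ => ENNReal.ofReal r * f (polarPoint r θ))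
      (2 * Real.pi) := fun θ => by simp only [polarPoint_add_two_pi]
  have h := setLIntegral_Ioc_eq_of_periodic Real.two_pi_pos hper (-Real.pi) 0
  rw [zero_add, show -Real.pi + 2 * Real.pi = Real.pi by ring] at h
  exact (setLIntegral_congr Ioo_ae_eq_Ioc).trans h

theorem setLIntegral_Ioc_zero_id {M : ℝ} (hM : 0 ≤ M) :
    ∫⁻ r in Ioc 0 M, ENNReal.ofReal r = ENNReal.ofReal (M ^ 2 / 2) := by
  rw [← ofReal_integral_eq_lintegral_ofReal, ← intervalIntegral.integral_of_le hM, integral_id]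
  · simp
  · exact (continuous_id.integrableOn_Icc).mono_set Ioc_subset_Icc_self
  · exact (ae_restrict_iff' measurableSet_Ioc).2 (ae_of_all _ fun x hx => hx.1.le)

/-- The area of a region that is star-shaped about the origin. -/
theorem volume_real_eq_polar {A : Set Plane} (hA : MeasurableSet A) {M : ℝ → ℝ}
    (hM : Continuous M) (hM0 : ∀ θ, 0 ≤ M θ)
    (h : ∀ r θ, 0 < r → (polarPoint r θ ∈ A ↔ r ≤ M θ)) :
    (volume : Measure Plane).real A = ∫ θ in 0..2 * Real.pi, M θ ^ 2 / 2 := by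
  have hm : Measurable (A.indicator (1 : Plane → ℝ≥0∞)) := measurable_one.indicator hA
  have key : volume A = ∫⁻ θ in Ioc 0 (2 * Real.pi), ENNReal.ofReal (M θ ^ 2 / 2) := by
    rw [← lintegral_indicator_one hA, lintegral_eq_polar hm, lintegral_lintegral_swap]
    · refine lintegral_congr fun θ => ?_
      rw [← setLIntegral_Ioc_zero_id (hM0 θ), ← Ioi_inter_Iic, inter_comm,
        ← setLIntegral_indicator measurableSet_Iic]
      refine setLIntegral_congr_fun measurableSet_Ioi fun r hr => ?_
      by_cases hr' : r ≤ M θ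
      · simp [indicator, (h r θ hr), hr']
      · simp [indicator, (h r θ hr), hr']
    · exact ((ENNReal.measurable_ofReal.comp measurable_fst).mul
        (hm.comp continuous_polarPoint.measurable)).aemeasurable
  rw [measureReal_def, key, ← ofReal_integral_eq_lintegral_ofReal,
    intervalIntegral.integral_of_le Real.two_pi_pos.le, ENNReal.toReal_ofReal]
  · exact integral_nonneg fun θ => by positivity
  · exact (Continuous.integrableOn_Icc (by fun_prop)).mono_set Ioc_subset_Icc_self
  · exact ae_of_all _ fun θ => by positivity

/-! ### Discs through the origin and the closed form of `V` -/

theorem polarPoint_mem_closedBall_iff {r s θ φ : ℝ} (hr : 0 < r) (hs : 0 < s) :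
    polarPoint s φ ∈ Metric.closedBall (polarPoint r θ) r ↔ s ≤ 2 * (r * Real.cos (φ - θ)) := by
  rw [Metric.mem_closedBall, EuclideanSpace.dist_eq, Real.sqrt_le_left hr.le]
  simp only [polarPoint, Fin.sum_univ_two, Real.dist_eq, sq_abs]
  simp only [Matrix.cons_val_zero, Matrix.cons_val_one, Real.cos_sub]
  have e : (s * Real.cos φ - r * Real.cos θ) ^ 2 + (s * Real.sin φ - r * Real.sin θ) ^ 2 - r ^ 2 =
      s * (s - 2 * (r * (Real.cos φ * Real.cos θ + Real.sin φ * Real.sin θ))) := by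
    linear_combination s ^ 2 * Real.cos_sq_add_sin_sq φ + r ^ 2 * Real.cos_sq_add_sin_sq θ
  rw [← sub_nonpos, e, mul_nonpos_iff_pos_imp_nonpos]
  constructor
  · intro h; linarith [h.1 hs]
  · intro h; exact ⟨fun _ => by linarith, fun h' => by linarith⟩

/-- The radial function of a union is the maximum of the radial functions; the outer `0` covers
directions that miss both discs. -/
theorem discUnionArea_eq_integral {r₁ r₂ : ℝ} (h₁ : 0 < r₁) (h₂ : 0 < r₂) (θ₁ θ₂ : ℝ) :
    discUnionArea r₁ θ₁ r₂ θ₂ = ∫ φ in 0..2 * Real.pi,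
      2 * max 0 (max (r₁ * Real.cos (φ - θ₁)) (r₂ * Real.cos (φ - θ₂))) ^ 2 := by
  rw [discUnionArea, volume_real_eq_polar (M := fun φ =>
    2 * max 0 (max (r₁ * Real.cos (φ - θ₁)) (r₂ * Real.cos (φ - θ₂))))]
  · congr 1; ext φ; ring
  · exact Metric.isClosed_closedBall.measurableSet.union Metric.isClosed_closedBall.measurableSet
  · fun_prop
  · intro θ; positivity
  · intro r θ hr
    rw [mem_union, polarPoint_mem_closedBall_iff h₁ hr, polarPoint_mem_closedBall_iff h₂ hr]
    simp only [← div_le_iff₀' (zero_lt_two' ℝ), le_max_iff]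
    have : ¬ r / 2 ≤ 0 := by linarith
    tauto

theorem integral_two_pi_sub_of_periodic {f : ℝ → ℝ} (hf : Function.Periodic f (2 * Real.pi))
    (a s : ℝ) :
    ∫ x in 0..2 * Real.pi, f (x - a) = ∫ x in s..s + 2 * Real.pi, f x := by
  rw [intervalIntegral.integral_comp_sub_right]
  have := hf.intervalIntegral_add_eq (0 - a) s
  rwa [show 0 - a + 2 * Real.pi = 2 * Real.pi - a by ring] at this

theorem discUnionArea_add {r₁ r₂ : ℝ} (h₁ : 0 < r₁) (h₂ : 0 < r₂) (θ u : ℝ) :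
    discUnionArea r₁ θ r₂ (θ + u) = V r₁ r₂ u := by
  rw [V, discUnionArea_eq_integral h₁ h₂, discUnionArea_eq_integral h₁ h₂]
  have hper : Function.Periodic (fun φ =>
      2 * max 0 (max (r₁ * Real.cos φ) (r₂ * Real.cos (φ - u))) ^ 2) (2 * Real.pi) := fun φ => by
    simp [Real.cos_add_two_pi, add_sub_right_comm]
  have h := integral_two_pi_sub_of_periodic hper θ 0
  simpa [sub_sub] using h

/-- By periodicity and the reflection `t ↦ -t` the integral depends on `α` only through `cos α`, so
`α` may be replaced by `v ∈ [0, π]`. The cosine then changes sign just once, at `t = π/2 - v`. -/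
theorem integral_sq_posPart_cos_add (α : ℝ) :
    ∫ t in (-(Real.pi / 2))..Real.pi / 2, 2 * max 0 (Real.cos (t + α)) ^ 2 =
      Real.pi - Real.arccos (Real.cos α) + Real.sin (2 * Real.arccos (Real.cos α)) / 2 := by
  set v := Real.arccos (Real.cos α) with hv
  have hv0 : 0 ≤ v := Real.arccos_nonneg _
  have hvπ : v ≤ Real.pi := Real.arccos_le_pi _
  have hcos : Real.cos v = Real.cos α :=
    Real.cos_arccos (Real.neg_one_le_cos _) (Real.cos_le_one _)
  have hred : ∫ t in (-(Real.pi / 2))..Real.pi / 2, 2 * max 0 (Real.cos (t + α)) ^ 2 =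
      ∫ t in (-(Real.pi / 2))..Real.pi / 2, 2 * max 0 (Real.cos (t + v)) ^ 2 := by
    obtain ⟨k, hk | hk⟩ := Real.cos_eq_cos_iff.1 hcos
    · congr 1; ext t
      rw [hk, show t + (2 * k * Real.pi + v) = t + v + k * (2 * Real.pi) by ring,
        Real.cos_add_int_mul_two_pi]
    · have := intervalIntegral.integral_comp_neg (a := -(Real.pi / 2)) (b := Real.pi / 2)
        (fun t => 2 * max 0 (Real.cos (t + v)) ^ 2)
      rw [neg_neg] at this
      rw [← this]
      congr 1; ext t
      rw [hk, show t + (2 * k * Real.pi - v) = -(-t + v) + k * (2 * Real.pi) by ring,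
        Real.cos_add_int_mul_two_pi, Real.cos_neg]
  have hcont : Continuous fun t => 2 * max 0 (Real.cos (t + v)) ^ 2 := by fun_prop
  rw [hred, ← intervalIntegral.integral_add_adjacent_intervals (b := Real.pi / 2 - v)
    (hcont.intervalIntegrable _ _) (hcont.intervalIntegrable _ _)]
  have e1 : ∫ t in (-(Real.pi / 2))..Real.pi / 2 - v, 2 * max 0 (Real.cos (t + v)) ^ 2 =
      ∫ t in (-(Real.pi / 2))..Real.pi / 2 - v, 2 * Real.cos (t + v) ^ 2 := by
    refine intervalIntegral.integral_congr fun t ht => ?_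
    rw [uIcc_of_le (by linarith)] at ht
    have : 0 ≤ Real.cos (t + v) :=
      Real.cos_nonneg_of_neg_pi_div_two_le_of_le (by linarith [ht.1]) (by linarith [ht.2])
    simp only [max_eq_right this]
  have e2 : ∫ t in (Real.pi / 2 - v)..Real.pi / 2, 2 * max 0 (Real.cos (t + v)) ^ 2 = 0 := by
    rw [intervalIntegral.integral_congr (g := fun _ => 0)]
    · simp
    intro t ht
    rw [uIcc_of_le (by linarith)] at ht
    have : Real.cos (t + v) ≤ 0 :=
      Real.cos_nonpos_of_pi_div_two_le_of_le (by linarith [ht.1]) (by linarith [ht.2])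
    simp [max_eq_left this]
  rw [e1, e2, intervalIntegral.integral_comp_add_right (fun t => 2 * Real.cos t ^ 2),
    intervalIntegral.integral_const_mul, integral_cos_sq,
    show -(Real.pi / 2) + v = v - Real.pi / 2 by ring, Real.cos_sub_pi_div_two,
    Real.sin_sub_pi_div_two, sub_add_cancel, Real.sin_two_mul]
  simp
  ring

theorem integral_sq_posPart_mul_cos_add {r : ℝ} (hr : 0 ≤ r) (α : ℝ) :
    ∫ t in (-(Real.pi / 2))..Real.pi / 2, 2 * max 0 (r * Real.cos (t + α)) ^ 2 =
      r ^ 2 * (Real.pi - Real.arccos (Real.cos α)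
        + Real.sin (2 * Real.arccos (Real.cos α)) / 2) := by
  rw [← integral_sq_posPart_cos_add, ← intervalIntegral.integral_const_mul]
  congr 1; ext t
  rw [show max 0 (r * Real.cos (t + α)) = r * max 0 (Real.cos (t + α)) by
    rw [mul_max_of_nonneg _ _ hr, mul_zero]]
  ring

/-- `(d, β)` are polar coordinates of the difference of the centres. Measured from direction `β`,
the two radial functions differ by a multiple of `cos t`, so each disc dominates on one half-turn.
-/
theorem V_eq_of_polar {r₁ r₂ u d β : ℝ} (h₁ : 0 < r₁) (h₂ : 0 < r₂) (hd : 0 < d)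
    (hc : r₁ - r₂ * Real.cos u = d * Real.cos β) (hs : -(r₂ * Real.sin u) = d * Real.sin β) :
    V r₁ r₂ u = (∫ t in (-(Real.pi / 2))..Real.pi / 2, 2 * max 0 (r₁ * Real.cos (t + β)) ^ 2) +
      ∫ t in (-(Real.pi / 2))..Real.pi / 2,
        2 * max 0 (r₂ * Real.cos (t + (Real.pi + β - u))) ^ 2 := by
  have hdiff : ∀ t, r₁ * Real.cos (t + β) - r₂ * Real.cos (t + β - u) = d * Real.cos t := by
    intro t
    rw [Real.cos_sub, Real.cos_add, Real.sin_add]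
    linear_combination (Real.cos t * Real.cos β - Real.sin t * Real.sin β) * hc
      + (Real.sin t * Real.cos β + Real.cos t * Real.sin β) * hs
      + d * Real.cos t * Real.cos_sq_add_sin_sq β
  set f : ℝ → ℝ := fun t =>
    2 * max 0 (max (r₁ * Real.cos (t + β)) (r₂ * Real.cos (t + β - u))) ^ 2 with hf
  have hcont : Continuous f := by fun_prop
  have hper : Function.Periodic f (2 * Real.pi) := fun t => by
    simp only [hf, add_right_comm t, add_sub_right_comm _ (2 * Real.pi), Real.cos_add_two_pi]
  have h := integral_two_pi_sub_of_periodic hper β (-(Real.pi / 2))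
  rw [V, discUnionArea_eq_integral h₁ h₂]
  simp only [hf, sub_add_cancel] at h
  simp only [sub_zero, h]
  rw [← intervalIntegral.integral_add_adjacent_intervals (b := Real.pi / 2)
    (hcont.intervalIntegrable _ _) (hcont.intervalIntegrable _ _)]
  congr 1
  · refine intervalIntegral.integral_congr fun t ht => ?_
    rw [uIcc_of_le (by linarith [Real.pi_pos])] at ht
    have := mul_nonneg hd.le (Real.cos_nonneg_of_neg_pi_div_two_le_of_le ht.1 ht.2)
    rw [← hdiff, sub_nonneg] at this
    simp only [hf, max_eq_left this]
  -- Shifting by `π` carries the other half-turn to `[-π/2, π/2]` and flips the sign of the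
  -- difference.
  · have e := intervalIntegral.integral_comp_add_right (a := -(Real.pi / 2)) (b := Real.pi / 2)
      f Real.pi
    rw [show -(Real.pi / 2) + Real.pi = Real.pi / 2 by ring,
      show Real.pi / 2 + Real.pi = -(Real.pi / 2) + 2 * Real.pi by ring] at e
    rw [← e]
    refine intervalIntegral.integral_congr fun t ht => ?_
    rw [uIcc_of_le (by linarith [Real.pi_pos])] at ht
    have := mul_nonneg hd.le (Real.cos_nonneg_of_neg_pi_div_two_le_of_le ht.1 ht.2)
    have h' := hdiff (t + Real.pi)
    rw [Real.cos_add_pi] at h'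
    have h'' : r₁ * Real.cos (t + Real.pi + β) ≤ r₂ * Real.cos (t + Real.pi + β - u) := by
      linarith
    simp only [hf, max_eq_right h'']
    ring_nf

theorem V_eq {r₁ r₂ u : ℝ} (h₁ : 0 < r₁) (h₂ : 0 < r₂)
    (hne : polarPoint r₁ 0 ≠ polarPoint r₂ u) :
    V r₁ r₂ u =
      r₁ ^ 2 * (Real.pi - vAngle r₁ r₂ u + Real.sin (2 * vAngle r₁ r₂ u) / 2) +
      r₂ ^ 2 * (Real.pi - wAngle r₁ r₂ u + Real.sin (2 * wAngle r₁ r₂ u) / 2) := by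
  -- First centre minus second, as a complex number: its modulus and argument serve as `d` and `β`.
  set z : ℂ := ⟨r₁ - r₂ * Real.cos u, -(r₂ * Real.sin u)⟩ with hz
  have hz0 : z ≠ 0 := by
    intro h
    have hre := congrArg Complex.re h
    have him := congrArg Complex.im h
    simp only [hz, Complex.zero_re, Complex.zero_im] at hre him
    refine hne ?_
    simp [polarPoint, show r₂ * Real.sin u = 0 by linarith, show r₁ = r₂ * Real.cos u by linarith]
  have hd : 0 < ‖z‖ := norm_pos_iff.2 hz0
  have hc : r₁ - r₂ * Real.cos u = ‖z‖ * Real.cos z.arg := (Complex.norm_mul_cos_arg z).symm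
  have hs : -(r₂ * Real.sin u) = ‖z‖ * Real.sin z.arg := (Complex.norm_mul_sin_arg z).symm
  have hnorm : Real.sqrt (r₁ ^ 2 + r₂ ^ 2 - 2 * r₁ * r₂ * Real.cos u) = ‖z‖ := by
    rw [Complex.norm_def, Complex.normSq_apply]
    congr 1
    simp only [hz]
    linear_combination -(r₂ ^ 2 * Real.cos_sq_add_sin_sq u)
  have hv : vAngle r₁ r₂ u = Real.arccos (Real.cos z.arg) := by
    rw [vAngle, hnorm, hc, mul_div_cancel_left₀ _ hd.ne']
  have hw : wAngle r₁ r₂ u = Real.arccos (Real.cos (Real.pi + z.arg - u)) := by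
    rw [wAngle, hnorm]
    congr 1
    rw [div_eq_iff hd.ne', add_sub_assoc, add_comm, Real.cos_add_pi, Real.cos_sub]
    linear_combination -(Real.cos u) * hc - Real.sin u * hs - r₂ * Real.cos_sq_add_sin_sq u
  rw [V_eq_of_polar h₁ h₂ hd hc hs, integral_sq_posPart_mul_cos_add h₁.le,
    integral_sq_posPart_mul_cos_add h₂.le, hv, hw]

/-! ### The radial Gaussian integral behind the mean -/

section Polar

theorem measurableSet_lt_norm (R : ℝ) : MeasurableSet {z : Plane | R < ‖z‖} :=
  measurableSet_lt measurable_const measurable_norm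

theorem setLIntegral_lt_norm_eq_polar {f : Plane → ℝ≥0∞} (hf : Measurable f) {R : ℝ}
    (hR : 0 ≤ R) :
    ∫⁻ z in {z | R < ‖z‖}, f z = ∫⁻ r in Ioi R, ∫⁻ θ in Ioc 0 (2 * Real.pi),
      ENNReal.ofReal r * f (polarPoint r θ) := by
  rw [← lintegral_indicator (measurableSet_lt_norm R),
    lintegral_eq_polar (hf.indicator (measurableSet_lt_norm R)),
    ← inter_eq_left.2 (Ioi_subset_Ioi hR), ← setLIntegral_indicator measurableSet_Ioi]
  refine setLIntegral_congr_fun measurableSet_Ioi fun r hr => ?_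
  by_cases h : R < r <;> simp [indicator, norm_polarPoint, abs_of_pos (mem_Ioi.1 hr), h]

theorem lintegral_Ioi_mul_exp_neg_mul_sq {b : ℝ} (hb : 0 < b) {R : ℝ} (hR : 0 ≤ R) :
    ∫⁻ r in Ioi R, ENNReal.ofReal (r * Real.exp (-(b * r ^ 2))) =
      ENNReal.ofReal (Real.exp (-(b * R ^ 2)) / (2 * b)) := by
  have hd : ∀ x ∈ Ici R, HasDerivAt (fun r => -(Real.exp (-(b * r ^ 2)) / (2 * b)))
      (x * Real.exp (-(b * x ^ 2))) x := fun x _ => by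
    have h := (((((hasDerivAt_pow 2 x).const_mul b).neg).exp).div_const (2 * b)).neg
    refine h.congr_deriv ?_
    simp
    field_simp
  have h0 : ∀ x ∈ Ioi R, 0 ≤ x * Real.exp (-(b * x ^ 2)) := fun x hx =>
    mul_nonneg (hR.trans (mem_Ioi.1 hx).le) (Real.exp_pos _).le
  have hl : Tendsto (fun r => -(Real.exp (-(b * r ^ 2)) / (2 * b))) atTop (𝓝 0) := by
    have h : Tendsto (fun r : ℝ => -(b * r ^ 2)) atTop atBot :=
      tendsto_neg_atTop_atBot.comp ((tendsto_pow_atTop two_ne_zero).const_mul_atTop hb)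
    simpa using ((Real.tendsto_exp_atBot.comp h).div_const (2 * b)).neg
  rw [← ofReal_integral_eq_lintegral_ofReal (integrableOn_Ioi_deriv_of_nonneg' hd h0 hl)
    ((ae_restrict_iff' measurableSet_Ioi).2 (ae_of_all _ h0)),
    integral_Ioi_of_hasDerivAt_of_nonneg' hd h0 hl, zero_sub, neg_neg]

theorem setLIntegral_lt_norm_exp_neg_mul_sq {lam : ℝ} (hlam : 0 < lam) {R : ℝ} (hR : 0 ≤ R) :
    ∫⁻ z in {z : Plane | R < ‖z‖}, ENNReal.ofReal (Real.exp (-(lam * (Real.pi * ‖z‖ ^ 2)))) =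
      ENNReal.ofReal (Real.exp (-(Real.pi * lam * R ^ 2)) / lam) := by
  have hb : 0 < Real.pi * lam := mul_pos Real.pi_pos hlam
  rw [setLIntegral_lt_norm_eq_polar (by fun_prop) hR]
  have h : ∀ r ∈ Ioi R, (∫⁻ θ in Ioc 0 (2 * Real.pi), ENNReal.ofReal r *
      ENNReal.ofReal (Real.exp (-(lam * (Real.pi * ‖polarPoint r θ‖ ^ 2))))) =
      ENNReal.ofReal (2 * Real.pi) *
        ENNReal.ofReal (r * Real.exp (-(Real.pi * lam * r ^ 2))) := fun r hr => by
    simp only [norm_polarPoint, sq_abs]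
    rw [lintegral_const, Measure.restrict_apply_univ, Real.volume_Ioc, sub_zero, mul_comm,
      ENNReal.ofReal_mul (hR.trans (mem_Ioi.1 hr).le)]
    ring_nf
  rw [setLIntegral_congr_fun measurableSet_Ioi h, lintegral_const_mul _ (by fun_prop),
    lintegral_Ioi_mul_exp_neg_mul_sq hb hR, ← ENNReal.ofReal_mul Real.two_pi_pos.le]
  congr 1
  field_simp

end Polar

/-! ### The two-point kernel: measurability, integrability, polar reduction -/

section UnionArea

theorem measurable_volume_real_union_closedBall :
    Measurable fun p : (Plane × ℝ) × (Plane × ℝ) => (volume : Measure Plane).real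
      (Metric.closedBall p.1.1 p.1.2 ∪ Metric.closedBall p.2.1 p.2.2) := by
  have hs : MeasurableSet {q : ((Plane × ℝ) × (Plane × ℝ)) × Plane |
      q.2 ∈ Metric.closedBall q.1.1.1 q.1.1.2 ∪ Metric.closedBall q.1.2.1 q.1.2.2} := by
    have h₁ : IsClosed {q : ((Plane × ℝ) × (Plane × ℝ)) × Plane | dist q.2 q.1.1.1 ≤ q.1.1.2} :=
      isClosed_le (by fun_prop) (by fun_prop)
    have h₂ : IsClosed {q : ((Plane × ℝ) × (Plane × ℝ)) × Plane | dist q.2 q.1.2.1 ≤ q.1.2.2} :=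
      isClosed_le (by fun_prop) (by fun_prop)
    exact (h₁.union h₂).measurableSet
  exact (measurable_measure_prodMk_left hs).ennreal_toReal

theorem measurable_V : Measurable fun p : ℝ × ℝ × ℝ => V p.1 p.2.1 p.2.2 := by
  have hp := continuous_polarPoint.measurable
  have h₁ : Measurable fun p : ℝ × ℝ × ℝ => polarPoint p.1 0 :=
    hp.comp (measurable_fst.prodMk measurable_const)
  have h₂ : Measurable fun p : ℝ × ℝ × ℝ => polarPoint p.2.1 p.2.2 := hp.comp measurable_snd
  have h := measurable_volume_real_union_closedBall.comp
    ((h₁.prodMk measurable_fst).prodMk (h₂.prodMk (measurable_fst.comp measurable_snd)))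
  simpa only [V, discUnionArea] using! h

theorem volume_real_closedBall_plane (x : Plane) {r : ℝ} (hr : 0 ≤ r) :
    (volume : Measure Plane).real (Metric.closedBall x r) = Real.pi * r ^ 2 := by
  rw [measureReal_def, EuclideanSpace.volume_closedBall_fin_two]
  simp [ENNReal.toReal_ofReal hr, Real.pi_pos.le, mul_comm]

/-- The union is at least as large as each disc, hence as their average. The resulting Gaussian
bound factorizes in `r₁` and `r₂`. -/
theorem half_pi_mul_add_sq_le_V {r₁ r₂ : ℝ} (h₁ : 0 ≤ r₁) (h₂ : 0 ≤ r₂) (u : ℝ) :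
    Real.pi / 2 * (r₁ ^ 2 + r₂ ^ 2) ≤ V r₁ r₂ u := by
  have hfin : (volume : Measure Plane) (Metric.closedBall (polarPoint r₁ 0) r₁ ∪
      Metric.closedBall (polarPoint r₂ u) r₂) ≠ ⊤ :=
    (measure_union_lt_top measure_closedBall_lt_top measure_closedBall_lt_top).ne
  have e₁ := measureReal_mono (subset_union_left (s := Metric.closedBall (polarPoint r₁ 0) r₁)
    (t := Metric.closedBall (polarPoint r₂ u) r₂)) hfin
  have e₂ := measureReal_mono (subset_union_right (s := Metric.closedBall (polarPoint r₁ 0) r₁)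
    (t := Metric.closedBall (polarPoint r₂ u) r₂)) hfin
  rw [volume_real_closedBall_plane _ h₁] at e₁
  rw [volume_real_closedBall_plane _ h₂] at e₂
  rw [V, discUnionArea]
  linarith

theorem periodic_V (r₁ r₂ : ℝ) : Function.Periodic (V r₁ r₂) (2 * Real.pi) := fun u => by
  simp only [V, discUnionArea, polarPoint_add_two_pi]

theorem integrableOn_exp_neg_mul_V {lam : ℝ} (hlam : 0 < lam) {R : ℝ} (hR : 0 ≤ R) :
    IntegrableOn (fun p : ℝ × ℝ × ℝ => Real.exp (-(lam * V p.1 p.2.1 p.2.2)) * p.2.1 * p.1)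
      (Ioi R ×ˢ Ioi R ×ˢ Ioc 0 (2 * Real.pi)) volume := by
  have hb : 0 < lam * (Real.pi / 2) := by positivity
  have hg : IntegrableOn (fun r : ℝ => r * Real.exp (-(lam * (Real.pi / 2)) * r ^ 2)) (Ioi R) :=
    (integrable_mul_exp_neg_mul_sq hb).integrableOn
  have hone : IntegrableOn (fun _ : ℝ => (1 : ℝ)) (Ioc 0 (2 * Real.pi)) :=
    integrableOn_const measure_Ioc_lt_top.ne
  have hdom := hg.mul_prod (hg.mul_prod hone)
  rw [Measure.prod_restrict, Measure.prod_restrict] at hdom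
  refine Integrable.mono' hdom (Measurable.aestronglyMeasurable ?_) ?_
  · exact ((((measurable_V.const_mul lam).neg).exp).mul (by fun_prop)).mul (by fun_prop)
  · refine (ae_restrict_iff' (measurableSet_Ioi.prod
      (measurableSet_Ioi.prod measurableSet_Ioc))).2 (ae_of_all _ ?_)
    rintro ⟨r₁, r₂, u⟩ ⟨h₁, h₂, -⟩
    have h₁' : 0 ≤ r₁ := hR.trans (mem_Ioi.1 h₁).le
    have h₂' : 0 ≤ r₂ := hR.trans (mem_Ioi.1 h₂).le
    simp only [mul_one]
    rw [Real.norm_of_nonneg (by positivity), show ∀ a b : ℝ, r₁ * a * (r₂ * b) = a * b * r₂ * r₁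
      from fun a b => by ring, ← Real.exp_add]
    gcongr
    nlinarith [half_pi_mul_add_sq_le_V h₁' h₂' u]

theorem integral_exp_neg_mul_V_eq {lam : ℝ} (hlam : 0 < lam) {R : ℝ} (hR : 0 ≤ R) :
    ∫ p in Ioi R ×ˢ Ioi R ×ˢ Ioc 0 (2 * Real.pi),
        Real.exp (-(lam * V p.1 p.2.1 p.2.2)) * p.2.1 * p.1 =
      ∫ r₁ in Ioi R, (∫ r₂ in Ioi R, (∫ u in (0 : ℝ)..(2 * Real.pi),
        Real.exp (-(lam * V r₁ r₂ u))) * r₂) * r₁ := by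
  have hint := integrableOn_exp_neg_mul_V hlam hR
  rw [Measure.volume_eq_prod, setIntegral_prod _ hint]
  rw [IntegrableOn, Measure.volume_eq_prod, ← Measure.prod_restrict] at hint
  refine integral_congr_ae ?_
  filter_upwards [hint.prod_right_ae] with r₁ h₁
  rw [Measure.volume_eq_prod, setIntegral_prod]
  · simp only [intervalIntegral.integral_of_le Real.two_pi_pos.le, integral_mul_const]
  · exact h₁

theorem lintegral_exp_neg_mul_V_eq {lam : ℝ} (hlam : 0 < lam) {R : ℝ} (hR : 0 ≤ R) :
    ∫⁻ r₁ in Ioi R, ∫⁻ r₂ in Ioi R, ∫⁻ u in Ioc 0 (2 * Real.pi),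
        ENNReal.ofReal (Real.exp (-(lam * V r₁ r₂ u)) * r₂ * r₁) =
      ENNReal.ofReal (∫ r₁ in Ioi R, (∫ r₂ in Ioi R, (∫ u in (0 : ℝ)..(2 * Real.pi),
        Real.exp (-(lam * V r₁ r₂ u))) * r₂) * r₁) := by
  have hm : Measurable fun p : ℝ × ℝ × ℝ =>
      ENNReal.ofReal (Real.exp (-(lam * V p.1 p.2.1 p.2.2)) * p.2.1 * p.1) :=
    (((((measurable_V.const_mul lam).neg).exp).mul (by fun_prop)).mul
      (by fun_prop)).ennreal_ofReal
  rw [← integral_exp_neg_mul_V_eq hlam hR,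
    ofReal_integral_eq_lintegral_ofReal (integrableOn_exp_neg_mul_V hlam hR),
    Measure.volume_eq_prod, setLIntegral_prod _ hm.aemeasurable]
  · refine lintegral_congr fun r₁ => ?_
    rw [Measure.volume_eq_prod, setLIntegral_prod]
    exact (hm.comp (measurable_prodMk_left (x := r₁))).aemeasurable
  · refine (ae_restrict_iff' (measurableSet_Ioi.prod
      (measurableSet_Ioi.prod measurableSet_Ioc))).2 (ae_of_all _ ?_)
    rintro ⟨r₁, r₂, u⟩ ⟨h₁, h₂, -⟩
    have h₁' : 0 ≤ r₁ := hR.trans (mem_Ioi.1 h₁).le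
    have h₂' : 0 ≤ r₂ := hR.trans (mem_Ioi.1 h₂).le
    simp only [Pi.zero_apply]
    positivity

/-- The area of the union of the discs centred at `x` and at `y` whose bounding circles pass
through the origin. -/
noncomputable def unionAreaThroughOrigin (x y : Plane) : ℝ :=
  (volume : Measure Plane).real (Metric.closedBall x ‖x‖ ∪ Metric.closedBall y ‖y‖)

theorem measurable_unionAreaThroughOrigin :
    Measurable fun p : Plane × Plane => unionAreaThroughOrigin p.1 p.2 := by
  have h := measurable_volume_real_union_closedBall.comp
    (by fun_prop : Measurable fun p : Plane × Plane => ((p.1, ‖p.1‖), (p.2, ‖p.2‖)))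
  simpa only [unionAreaThroughOrigin] using! h

theorem unionAreaThroughOrigin_polarPoint {r₁ r₂ : ℝ} (h₁ : 0 < r₁) (h₂ : 0 < r₂) (θ₁ θ₂ : ℝ) :
    unionAreaThroughOrigin (polarPoint r₁ θ₁) (polarPoint r₂ θ₂) = V r₁ r₂ (θ₂ - θ₁) := by
  rw [← discUnionArea_add h₁ h₂ θ₁, add_sub_cancel, unionAreaThroughOrigin, discUnionArea,
    norm_polarPoint, norm_polarPoint, abs_of_pos h₁, abs_of_pos h₂]

theorem lintegral_exp_neg_unionAreaThroughOrigin {lam : ℝ} (hlam : 0 < lam) {R : ℝ}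
    (hR : 0 ≤ R) :
    ∫⁻ p in {x : Plane | R < ‖x‖} ×ˢ {y : Plane | R < ‖y‖},
        ENNReal.ofReal (Real.exp (-(lam * unionAreaThroughOrigin p.1 p.2))) =
      ENNReal.ofReal (2 * Real.pi * ∫ r₁ in Ioi R, (∫ r₂ in Ioi R,
        (∫ u in (0 : ℝ)..(2 * Real.pi), Real.exp (-(lam * V r₁ r₂ u))) * r₂) * r₁) := by
  have hm : Measurable fun p : Plane × Plane =>
      ENNReal.ofReal (Real.exp (-(lam * unionAreaThroughOrigin p.1 p.2))) :=
    (((measurable_unionAreaThroughOrigin.const_mul lam).neg).exp).ennreal_ofReal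
  rw [Measure.volume_eq_prod, setLIntegral_prod _ hm.aemeasurable,
    setLIntegral_lt_norm_eq_polar (Measurable.lintegral_prod_right' hm) hR,
    ENNReal.ofReal_mul Real.two_pi_pos.le, ← lintegral_exp_neg_mul_V_eq hlam hR,
    ← lintegral_const_mul' _ _ ENNReal.ofReal_ne_top]
  refine setLIntegral_congr_fun measurableSet_Ioi fun r₁ h₁ => ?_
  have h₁' : 0 < r₁ := hR.trans_lt h₁
  have inner : ∀ θ₁, ENNReal.ofReal r₁ * ∫⁻ y in {y : Plane | R < ‖y‖},
      ENNReal.ofReal (Real.exp (-(lam * unionAreaThroughOrigin (polarPoint r₁ θ₁) y))) =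
      ∫⁻ r₂ in Ioi R, ∫⁻ u in Ioc 0 (2 * Real.pi),
        ENNReal.ofReal (Real.exp (-(lam * V r₁ r₂ u)) * r₂ * r₁) := by
    intro θ₁
    have hmθ : Measurable fun y : Plane => ENNReal.ofReal
        (Real.exp (-(lam * unionAreaThroughOrigin (polarPoint r₁ θ₁) y))) :=
      ((((measurable_unionAreaThroughOrigin.comp measurable_prodMk_left).const_mul
        lam).neg).exp).ennreal_ofReal
    rw [setLIntegral_lt_norm_eq_polar hmθ hR,
      ← lintegral_const_mul' _ _ ENNReal.ofReal_ne_top]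
    refine setLIntegral_congr_fun measurableSet_Ioi fun r₂ h₂ => ?_
    have h₂' : 0 < r₂ := hR.trans_lt h₂
    have hper : Function.Periodic (fun u =>
        ENNReal.ofReal (Real.exp (-(lam * V r₁ r₂ u)) * r₂ * r₁)) (2 * Real.pi) := fun u => by
      simp only [periodic_V r₁ r₂ u]
    -- The integrand depends on `θ₂ - θ₁` only, and periodicity absorbs the shift, so the inner
    -- integral is independent of `θ₁`.
    have hshift := setLIntegral_Ioc_sub_of_periodic Real.two_pi_pos hper θ₁ 0
    rw [zero_add] at hshift
    rw [← hshift, ← lintegral_const_mul' _ _ ENNReal.ofReal_ne_top]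
    refine lintegral_congr fun θ₂ => ?_
    rw [unionAreaThroughOrigin_polarPoint h₁' h₂', ENNReal.ofReal_mul (by positivity),
      ENNReal.ofReal_mul (by positivity)]
    ring
  simp only [inner, lintegral_const, Measure.restrict_apply_univ, Real.volume_Ioc, sub_zero]
  rw [mul_comm]

end UnionArea

/-! ### Void probabilities and Tonelli for the moments of the area -/

section Moments

variable {Ω : Type*} [MeasurableSpace Ω] {P : Measure Ω} {Φ : Ω → Set Plane} {lam : ℝ}

theorem IsHomogeneousPPP.measure_inter_eq_empty (hΦ : IsHomogeneousPPP Φ lam P) (hlam : 0 ≤ lam)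
    {B : Set Plane} (hB : MeasurableSet B) (hfin : (volume : Measure Plane) B ≠ ⊤) :
    P {ω | Φ ω ∩ B = ∅} =
      ENNReal.ofReal (Real.exp (-(lam * (volume : Measure Plane).real B))) := by
  have hν : (ENNReal.ofReal lam • (volume : Measure Plane)) B ≠ ⊤ := by
    simpa using ENNReal.mul_ne_top ENNReal.ofReal_ne_top hfin
  have h := DFunLike.congr_fun (hΦ.law_count B hB hν) {0}
  rw [Measure.map_apply (hΦ.measurable_count B hB) (measurableSet_singleton _),
    Measure.map_apply (by fun_prop) (measurableSet_singleton _)] at h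
  have e₁ : (fun ω => (Φ ω ∩ B).encard) ⁻¹' {0} = {ω | Φ ω ∩ B = ∅} := by
    ext ω; simp
  have e₂ : (fun n : ℕ => (n : ℕ∞)) ⁻¹' {0} = {0} := by
    ext n; simp
  rw [e₁, e₂, poissonMeasure_singleton] at h
  rw [h]
  simp [measureReal_def, ENNReal.coe_toNNReal_eq_toReal, ENNReal.toReal_ofReal hlam]

theorem IsHomogeneousPPP.measurableSet_inter_nonempty (hΦ : IsHomogeneousPPP Φ lam P)
    {B : Set Plane} (hB : MeasurableSet B) : MeasurableSet {ω | (Φ ω ∩ B).Nonempty} := by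
  have h := hΦ.measurable_count B hB (measurableSet_singleton (0 : ℕ∞)).compl
  convert h using 1
  ext ω; simp [nonempty_iff_ne_empty]

/-- The added origin lies on the boundary of the disc, so it never obstructs. -/
theorem mem_typicalCellEdgeRegion_iff {S : Set Plane} {R : ℝ} {x : Plane} :
    x ∈ typicalCellEdgeRegion S R ↔ S ∩ Metric.ball x ‖x‖ = ∅ ∧ R < ‖x‖ := by
  simp only [typicalCellEdgeRegion, cellEdgeRegion, voronoiCell, mem_ofPred_eq, dist_zero_right,
    eq_empty_iff_forall_notMem, mem_inter_iff, Metric.mem_ball, not_and, not_lt]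
  refine and_congr_left fun _ => ⟨fun h p hp => ?_, fun h p hp => ?_⟩
  · rw [dist_comm]; exact h p (Or.inl hp)
  · rcases hp with hp | rfl
    · rw [dist_comm]; exact h p hp
    · simp

/-- Writes the hitting of a variable ball as a countable union of conditions that separate `S` from
`x`; this gives joint measurability in `(ω, x)`. -/
theorem inter_ball_nonempty_iff {S : Set Plane} {x : Plane} {r : ℝ} :
    (S ∩ Metric.ball x r).Nonempty ↔ ∃ (n : ℕ) (s : ℚ),
      (S ∩ Metric.ball (TopologicalSpace.denseSeq Plane n) s).Nonempty ∧
        dist (TopologicalSpace.denseSeq Plane n) x + s ≤ r := by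
  constructor
  · rintro ⟨p, hp, hpx⟩
    rw [Metric.mem_ball] at hpx
    -- Half the gap suffices: the triangle inequality through `p` uses `s` twice.
    obtain ⟨s, hs0, hs⟩ := exists_rat_btwn (show (0 : ℝ) < (r - dist p x) / 2 by linarith)
    obtain ⟨n, hn⟩ := Metric.denseRange_iff.1 (TopologicalSpace.denseRange_denseSeq Plane) p s hs0
    refine ⟨n, s, ⟨p, hp, hn⟩, ?_⟩
    have := dist_triangle_left (TopologicalSpace.denseSeq Plane n) x p
    linarith
  · rintro ⟨n, s, ⟨p, hp, hps⟩, h⟩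
    refine ⟨p, hp, ?_⟩
    rw [Metric.mem_ball] at hps ⊢
    linarith [dist_triangle p (TopologicalSpace.denseSeq Plane n) x]

theorem IsHomogeneousPPP.measurableSet_typicalCellEdgeRegion (hΦ : IsHomogeneousPPP Φ lam P)
    (R : ℝ) : MeasurableSet {p : Ω × Plane | p.2 ∈ typicalCellEdgeRegion (Φ p.1) R} := by
  have e : {p : Ω × Plane | p.2 ∈ typicalCellEdgeRegion (Φ p.1) R} =
      (⋃ (n : ℕ) (s : ℚ),
        {ω | (Φ ω ∩ Metric.ball (TopologicalSpace.denseSeq Plane n) s).Nonempty} ×ˢ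
        {x | dist (TopologicalSpace.denseSeq Plane n) x + s ≤ ‖x‖})ᶜ ∩
      Prod.snd ⁻¹' {x | R < ‖x‖} := by
    ext ⟨ω, x⟩
    rw [mem_ofPred_eq, mem_typicalCellEdgeRegion_iff, ← not_nonempty_iff_eq_empty,
      inter_ball_nonempty_iff]
    simp
  rw [e]
  refine MeasurableSet.inter (MeasurableSet.compl ?_) (measurable_snd (measurableSet_lt_norm R))
  refine MeasurableSet.iUnion fun n => MeasurableSet.iUnion fun s => ?_
  exact (hΦ.measurableSet_inter_nonempty Metric.isOpen_ball.measurableSet).prod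
    (measurableSet_le (by fun_prop) (by fun_prop))

theorem IsHomogeneousPPP.measure_mem_typicalCellEdgeRegion (hΦ : IsHomogeneousPPP Φ lam P)
    (hlam : 0 ≤ lam) (R : ℝ) (x : Plane) :
    P {ω | x ∈ typicalCellEdgeRegion (Φ ω) R} = {x : Plane | R < ‖x‖}.indicator
      (fun x => ENNReal.ofReal (Real.exp (-(lam * (Real.pi * ‖x‖ ^ 2))))) x := by
  simp only [mem_typicalCellEdgeRegion_iff]
  by_cases h : R < ‖x‖
  · simp only [h, and_true, indicator, mem_ofPred_eq, if_true]
    rw [hΦ.measure_inter_eq_empty hlam Metric.isOpen_ball.measurableSet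
      measure_ball_lt_top.ne, ← volume_real_closedBall_plane x (norm_nonneg x), measureReal_def,
      measureReal_def, Measure.addHaar_closedBall_eq_addHaar_ball]
  · simp [h, indicator]

/-- The cell condition involves open discs and `V` closed ones; circles are null. -/
theorem volume_real_union_ball (x y : Plane) :
    (volume : Measure Plane).real (Metric.ball x ‖x‖ ∪ Metric.ball y ‖y‖) =
      unionAreaThroughOrigin x y := by
  have h : ∀ z : Plane, (Metric.ball z ‖z‖ : Set Plane) =ᵐ[volume] Metric.closedBall z ‖z‖ :=
    fun z => ae_eq_of_subset_of_measure_ge Metric.ball_subset_closedBall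
      (Measure.addHaar_closedBall_eq_addHaar_ball _ _ _).le
      Metric.isOpen_ball.measurableSet.nullMeasurableSet measure_closedBall_lt_top.ne
  rw [unionAreaThroughOrigin, measureReal_def, measureReal_def, measure_congr ((h x).union (h y))]

theorem IsHomogeneousPPP.measure_pair_mem_typicalCellEdgeRegion (hΦ : IsHomogeneousPPP Φ lam P)
    (hlam : 0 ≤ lam) (R : ℝ) (p : Plane × Plane) :
    P {ω | p ∈ typicalCellEdgeRegion (Φ ω) R ×ˢ typicalCellEdgeRegion (Φ ω) R} =
      ({x : Plane | R < ‖x‖} ×ˢ {y : Plane | R < ‖y‖}).indicator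
      (fun p => ENNReal.ofReal (Real.exp (-(lam * unionAreaThroughOrigin p.1 p.2)))) p := by
  obtain ⟨x, y⟩ := p
  simp only [mem_prod, mem_typicalCellEdgeRegion_iff]
  by_cases h : R < ‖x‖ ∧ R < ‖y‖
  · simp only [h, and_true, indicator, mem_prod, mem_ofPred_eq, and_self, if_true]
    rw [← volume_real_union_ball, ← hΦ.measure_inter_eq_empty hlam
      (Metric.isOpen_ball.union Metric.isOpen_ball).measurableSet
      (measure_union_lt_top measure_ball_lt_top measure_ball_lt_top).ne]
    simp only [inter_union_distrib_left, union_empty_iff]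
  · rw [indicator_of_notMem (by simpa using h)]
    convert measure_empty (μ := P)
    ext ω
    simp only [mem_ofPred_eq, mem_empty_iff_false, iff_false]
    tauto

theorem lintegral_measure_eq_lintegral_measure_mem {Z : Type*} [MeasurableSpace Z]
    {μ : Measure Z} [SFinite μ] [SFinite P] {A : Ω → Set Z}
    (hA : MeasurableSet {p : Ω × Z | p.2 ∈ A p.1}) :
    ∫⁻ ω, μ (A ω) ∂P = ∫⁻ z, P {ω | z ∈ A ω} ∂μ :=
  (Measure.prod_apply hA).symm.trans (Measure.prod_apply_symm hA)

variable [SFinite P]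

theorem IsHomogeneousPPP.lintegral_volume_typicalCellEdgeRegion (hΦ : IsHomogeneousPPP Φ lam P)
    (hlam : 0 < lam) {R : ℝ} (hR : 0 ≤ R) :
    ∫⁻ ω, volume (typicalCellEdgeRegion (Φ ω) R) ∂P =
      ENNReal.ofReal (Real.exp (-(Real.pi * lam * R ^ 2)) / lam) := by
  rw [lintegral_measure_eq_lintegral_measure_mem (hΦ.measurableSet_typicalCellEdgeRegion R)]
  simp only [hΦ.measure_mem_typicalCellEdgeRegion hlam.le]
  rw [lintegral_indicator (measurableSet_lt_norm R), setLIntegral_lt_norm_exp_neg_mul_sq hlam hR]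

theorem IsHomogeneousPPP.lintegral_volume_typicalCellEdgeRegion_sq
    (hΦ : IsHomogeneousPPP Φ lam P) (hlam : 0 < lam) {R : ℝ} (hR : 0 ≤ R) :
    ∫⁻ ω, volume (typicalCellEdgeRegion (Φ ω) R) ^ 2 ∂P =
      ENNReal.ofReal (2 * Real.pi * ∫ r₁ in Ioi R, (∫ r₂ in Ioi R,
        (∫ u in (0 : ℝ)..(2 * Real.pi), Real.exp (-(lam * V r₁ r₂ u))) * r₂) * r₁) := by
  have hS := hΦ.measurableSet_typicalCellEdgeRegion R
  have hS₂ : MeasurableSet {q : Ω × (Plane × Plane) |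
      q.2 ∈ typicalCellEdgeRegion (Φ q.1) R ×ˢ typicalCellEdgeRegion (Φ q.1) R} :=
    ((by fun_prop : Measurable fun q : Ω × (Plane × Plane) => (q.1, q.2.1)) hS).inter
      ((by fun_prop : Measurable fun q : Ω × (Plane × Plane) => (q.1, q.2.2)) hS)
  simp only [sq (volume (typicalCellEdgeRegion _ _)), ← Measure.prod_prod]
  rw [← Measure.volume_eq_prod, lintegral_measure_eq_lintegral_measure_mem hS₂]
  simp only [hΦ.measure_pair_mem_typicalCellEdgeRegion hlam.le]
  rw [lintegral_indicator ((measurableSet_lt_norm R).prod (measurableSet_lt_norm R)),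
    lintegral_exp_neg_unionAreaThroughOrigin hlam hR]

end Moments

end PoissonVoronoi

/-! ### Assembly: from `ℝ≥0∞` moments to real ones -/

theorem lemma1 {Ω : Type*} [MeasurableSpace Ω] (P : Measure Ω) [IsProbabilityMeasure P]
    (lam Rc : ℝ) (hlam : 0 < lam) (hRc : 0 ≤ Rc)
    (Φ : Ω → Set PoissonVoronoi.Plane) (hΦ : PoissonVoronoi.IsHomogeneousPPP Φ lam P) :
    -- the area is almost surely finite and is a random variable with a finite second moment
    (∀ᵐ ω ∂P, volume (PoissonVoronoi.typicalCellEdgeRegion (Φ ω) Rc) < ⊤) ∧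
    MemLp (fun ω => PoissonVoronoi.typicalCellEdgeArea (Φ ω) Rc) 2 P ∧
    -- the mean
    (∫ ω, PoissonVoronoi.typicalCellEdgeArea (Φ ω) Rc ∂P =
      Real.exp (-(Real.pi * lam * Rc ^ 2)) / lam) ∧
    -- the triple integral converges absolutely and is equal to the second moment
    IntegrableOn
      (fun p : ℝ × ℝ × ℝ =>
        Real.exp (-(lam * PoissonVoronoi.V p.1 p.2.1 p.2.2)) * p.2.1 * p.1)
      (Set.Ioi Rc ×ˢ Set.Ioi Rc ×ˢ Set.Ioc 0 (2 * Real.pi)) volume ∧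
    (∫ ω, PoissonVoronoi.typicalCellEdgeArea (Φ ω) Rc ^ 2 ∂P =
      2 * Real.pi *
        ∫ r₁ in Set.Ioi Rc,
          (∫ r₂ in Set.Ioi Rc,
            (∫ u in (0 : ℝ)..(2 * Real.pi),
              Real.exp (-(lam * PoissonVoronoi.V r₁ r₂ u))) * r₂) * r₁) ∧
    -- the area of the union depends on the angular separation only, and its explicit value
    (∀ r₁ r₂ θ u : ℝ, 0 < r₁ → 0 < r₂ →
      PoissonVoronoi.discUnionArea r₁ θ r₂ (θ + u) = PoissonVoronoi.V r₁ r₂ u) ∧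
    (∀ r₁ r₂ u : ℝ, 0 < r₁ → 0 < r₂ →
      PoissonVoronoi.polarPoint r₁ 0 ≠ PoissonVoronoi.polarPoint r₂ u →
      PoissonVoronoi.V r₁ r₂ u =
        r₁ ^ 2 * (Real.pi - PoissonVoronoi.vAngle r₁ r₂ u
          + Real.sin (2 * PoissonVoronoi.vAngle r₁ r₂ u) / 2) +
        r₂ ^ 2 * (Real.pi - PoissonVoronoi.wAngle r₁ r₂ u
          + Real.sin (2 * PoissonVoronoi.wAngle r₁ r₂ u) / 2)) := by
  have hm : Measurable fun ω => volume (PoissonVoronoi.typicalCellEdgeRegion (Φ ω) Rc) :=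
    measurable_measure_prodMk_left (hΦ.measurableSet_typicalCellEdgeRegion Rc)
  have h₁ := hΦ.lintegral_volume_typicalCellEdgeRegion hlam hRc
  have h₂ := hΦ.lintegral_volume_typicalCellEdgeRegion_sq hlam hRc
  have hfin : ∀ᵐ ω ∂P, volume (PoissonVoronoi.typicalCellEdgeRegion (Φ ω) Rc) < ⊤ :=
    ae_lt_top hm (h₁ ▸ ENNReal.ofReal_ne_top)
  have hsq : ∀ ω, PoissonVoronoi.typicalCellEdgeArea (Φ ω) Rc ^ 2 =
      (volume (PoissonVoronoi.typicalCellEdgeRegion (Φ ω) Rc) ^ 2).toReal := fun ω => by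
    rw [ENNReal.toReal_pow]; rfl
  refine ⟨hfin, ?_, ?_, PoissonVoronoi.integrableOn_exp_neg_mul_V hlam hRc, ?_,
    fun r₁ r₂ θ u hr₁ hr₂ => PoissonVoronoi.discUnionArea_add hr₁ hr₂ θ u,
    fun r₁ r₂ u hr₁ hr₂ hne => PoissonVoronoi.V_eq hr₁ hr₂ hne⟩
  · refine (memLp_two_iff_integrable_sq hm.ennreal_toReal.aestronglyMeasurable).2 ?_
    change Integrable (fun ω => PoissonVoronoi.typicalCellEdgeArea (Φ ω) Rc ^ 2) P
    simp only [hsq]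
    exact integrable_toReal_of_lintegral_ne_top (hm.pow_const 2).aemeasurable
      (h₂ ▸ ENNReal.ofReal_ne_top)
  · refine (integral_toReal hm.aemeasurable hfin).trans ?_
    rw [h₁, ENNReal.toReal_ofReal (by positivity)]
  · simp only [hsq]
    rw [integral_toReal (hm.pow_const 2).aemeasurable
      (hfin.mono fun ω h => ENNReal.pow_lt_top h), h₂, ENNReal.toReal_ofReal]
    refine mul_nonneg Real.two_pi_pos.le (setIntegral_nonneg measurableSet_Ioi fun r₁ hr₁ =>
      mul_nonneg (setIntegral_nonneg measurableSet_Ioi fun r₂ hr₂ => mul_nonneg ?_ ?_) ?_)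
    · exact intervalIntegral.integral_nonneg Real.two_pi_pos.le fun u _ => (Real.exp_pos _).le
    · exact hRc.trans (Set.mem_Ioi.1 hr₂).le
    · exact hRc.trans (Set.mem_Ioi.1 hr₁).le
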